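/- Let $F_n$ denote the $n$-th Fibonacci number ($F_0=0$, $F_1=1$, $F_{n+2}=F_{n+1}+F_n$) and, for real $x$, let $A(x)=\#\{n\in\mathbb{N} : 1\le n\le x,\ n\mid F_n\}$. Then there is a function $\varepsilon:\mathbb{R}\to\mathbb{R}$ with $\varepsilon(x)\to 0$ as $x\to\infty$ such that for all sufficiently large $x$ $$\log A(x)\le \log x-\left(\tfrac12+\varepsilon(x)\right)\frac{\log x\,\log\log\log x}{\log\log x},$$ or, equivalently, $$A(x)\le x^{\,1-\left(\frac12+\varepsilon(x)\right)\frac{\log\log\log x}{\log\log x}}.$$ -/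

import Mathlib

open Real Filter Topology

/-- The set of self-Fibonacci divisors: positive integers `n` dividing the `n`-th Fibonacci
number. -/
def selfFibDivisors : Set ℕ := {n : ℕ | 0 < n ∧ n ∣ Nat.fib n}

/-- The counting function `A(x) = #{n ≤ x : n ∣ F_n}` for real `x`. -/
noncomputable def selfFibCount (x : ℝ) : ℕ :=
  Set.ncard {n : ℕ | n ∈ selfFibDivisors ∧ (n : ℝ) ≤ x}

/-!
Let `z(n)` be the rank of apparition of `n`, the least `d > 0` with `n ∣ F_d`; then `n ∣ F_m` if and
only if `z(n) ∣ m`, so `A(x)` counts the `n ≤ x` with `z(n) ∣ n`. For a constant `c < 1/2`, put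
`η = c log log log x / log log x` and compare `z(n)` with `x ^ η`.

If `z(n) > x ^ η`, the cofactor `k = n / z(n)` is at most `x ^ (1 - η)`, so it suffices that few `n`
share a given `k`. Such an `n` is determined by its part supported on the primes dividing `30k`: for
a prime `p ∤ 30k` dividing `n`, the full power of `p` in `n` divides `z(n)`, hence `z(q)` for some
prime `q ∣ n`, and `q > p` because `z(q)` divides `q ± 1`; descending induction on `p` recovers that
power. Rankin's trick bounds the number of possible parts by `x ^ o(η)`.

If `d = z(n) ≤ x ^ η`, then `n / d ≤ x / d` is composed of primes dividing `F_d`, and Rankin's trick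
with exponent `1 - η` bounds the number of such `n` by `(x / d) ^ (1 - η)` times an Euler product
over those primes. There are at most `e` primes of rank `e`, and they lie in three residue classes
modulo `e`, so the logarithm of this product is `O(1/η)` times the sum of `e ^ (2η - 1)` over
`e ∣ d`. The latter is at most `exp ((log x) ^ (2η) (log log x) ^ o(1))`, and the exponent is
`(log log x) ^ (2c + o(1)) = o(log log x)`, which is where `c < 1/2` is needed.
-/

theorem fib_mul_sub_eq {R : Type*} [CommRing R] {a b : R} (hadd : a + b = 1) (hmul : a * b = -1)
    (n : ℕ) : (Nat.fib n : R) * (a - b) = a ^ n - b ^ n := by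
  induction n using Nat.twoStepInduction with
  | zero => simp
  | one => simp
  | more n h₁ h₂ =>
    rw [Nat.fib_add_two, Nat.cast_add, add_mul, h₁, h₂]
    linear_combination (a ^ n - b ^ n) * hmul + (b ^ (n + 1) - a ^ (n + 1)) * hadd

theorem exists_add_eq_one_mul_eq_neg_one (K : Type*) [Field K] [IsAlgClosed K] :
    ∃ a b : K, a + b = 1 ∧ a * b = -1 := by
  have hdeg : (Polynomial.X ^ 2 - Polynomial.X - 1 : Polynomial K).degree = 2 := by
    compute_degree!
  obtain ⟨a, ha⟩ := IsAlgClosed.exists_root _ (hdeg.trans_ne two_ne_zero)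
  refine ⟨a, 1 - a, by ring, ?_⟩
  simp only [Polynomial.IsRoot.def, Polynomial.eval_sub, Polynomial.eval_pow, Polynomial.eval_X,
    Polynomial.eval_one] at ha
  linear_combination -ha

theorem prime_dvd_fib_pred_or_succ {q : ℕ} (hq : q.Prime) (h5 : q ≠ 5) :
    q ∣ Nat.fib (q - 1) ∨ q ∣ Nat.fib (q + 1) := by
  have := Fact.mk hq
  let K := AlgebraicClosure (ZMod q)
  obtain ⟨a, b, hadd, hmul⟩ := exists_add_eq_one_mul_eq_neg_one K
  have hdisc : a - b ≠ 0 := by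
    intro h
    have h5' : ((5 : ℕ) : K) = 0 := by
      push_cast
      linear_combination (a - b) * h - (a + b + 1) * hadd + 4 * hmul
    exact h5 ((Nat.prime_dvd_prime_iff_eq hq Nat.prime_five).1
      ((CharP.cast_eq_zero_iff K q 5).1 h5'))
  have dvd_fib : ∀ n, a ^ n = b ^ n → q ∣ Nat.fib n := fun n h ↦ by
    have := fib_mul_sub_eq hadd hmul n
    rw [h, sub_self] at this
    exact (CharP.cast_eq_zero_iff K q _).1 ((mul_eq_zero.1 this).resolve_right hdisc)
  have frob_add : a ^ q + b ^ q = 1 := by rw [← add_pow_char, hadd, one_pow]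
  -- The Frobenius map permutes the two roots of `X ^ 2 - X - 1`.
  have frob_root : a ^ q * a ^ q = a ^ q + 1 := by
    rw [← mul_pow, show a * a = a + 1 by linear_combination a * hadd - hmul, add_pow_char, one_pow]
  have frob_cases : (a ^ q - a) * (a ^ q - b) = 0 := by
    linear_combination frob_root + hmul - a ^ q * hadd
  have hab : a * b ≠ 0 := by rw [hmul]; exact neg_ne_zero.2 one_ne_zero
  rcases mul_eq_zero.1 frob_cases with h | h
  · have ha : a ^ q = a := sub_eq_zero.1 h
    have hb : b ^ q = b := by linear_combination frob_add - ha - hadd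
    rw [← pow_sub_one_mul hq.ne_zero] at ha hb
    refine .inl (dvd_fib _ ?_)
    rw [(mul_eq_right₀ (left_ne_zero_of_mul hab)).1 ha,
      (mul_eq_right₀ (right_ne_zero_of_mul hab)).1 hb]
  · have ha : a ^ q = b := sub_eq_zero.1 h
    have hb : b ^ q = a := by linear_combination frob_add - ha - hadd
    exact .inr (dvd_fib _ (by rw [pow_succ, pow_succ, ha, hb, mul_comm]))

theorem fib_mul_add_one_modEq (k m : ℕ) :
    Nat.fib (k * (m + 1) + 1) ≡ Nat.fib m ^ k [MOD Nat.fib (m + 1)] := by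
  induction k with
  | zero => simp [Nat.ModEq.refl]
  | succ k ih =>
    have hstep : Nat.fib (m + 1 + 1) ≡ Nat.fib m [MOD Nat.fib (m + 1)] := by
      rw [Nat.fib_add_two]; exact Nat.add_modEq_right
    calc Nat.fib ((k + 1) * (m + 1) + 1)
        = Nat.fib (k * (m + 1)) * Nat.fib (m + 1)
            + Nat.fib (k * (m + 1) + 1) * Nat.fib (m + 1 + 1) := by
          rw [← Nat.fib_add, add_one_mul]
      _ ≡ 0 + Nat.fib m ^ k * Nat.fib m [MOD Nat.fib (m + 1)] :=
          (Nat.modEq_zero_iff_dvd.2 (dvd_mul_left _ _)).add (ih.mul hstep)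
      _ = Nat.fib m ^ (k + 1) := by rw [zero_add, pow_succ]

theorem fib_succ_mul_modEq (k m : ℕ) :
    Nat.fib ((k + 1) * (m + 1)) ≡ (k + 1) * Nat.fib (m + 1) * Nat.fib m ^ k
      [MOD Nat.fib (m + 1) ^ 2] := by
  induction k with
  | zero => simp [Nat.ModEq.refl]
  | succ k ih =>
    have hlast : Nat.fib ((k + 1) * (m + 1) + 1) * Nat.fib (m + 1) ≡
        Nat.fib m ^ (k + 1) * Nat.fib (m + 1) [MOD Nat.fib (m + 1) ^ 2] := by
      rw [sq]; exact (fib_mul_add_one_modEq (k + 1) m).mul_right' _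
    calc Nat.fib ((k + 1 + 1) * (m + 1))
        = Nat.fib ((k + 1) * (m + 1)) * Nat.fib m
            + Nat.fib ((k + 1) * (m + 1) + 1) * Nat.fib (m + 1) := by
          rw [← Nat.fib_add, add_one_mul (k + 1), ← add_assoc]
      _ ≡ (k + 1) * Nat.fib (m + 1) * Nat.fib m ^ k * Nat.fib m
            + Nat.fib m ^ (k + 1) * Nat.fib (m + 1) [MOD Nat.fib (m + 1) ^ 2] :=
          (ih.mul_right _).add hlast
      _ = (k + 1 + 1) * Nat.fib (m + 1) * Nat.fib m ^ (k + 1) := by ring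

theorem mul_dvd_fib_mul {k l m : ℕ} (hk : k ∣ Nat.fib m) (hl : l ∣ Nat.fib m) :
    k * l ∣ Nat.fib (k * m) := by
  obtain _ | k := k
  · simp
  obtain _ | m := m
  · simp
  have hsq : (k + 1) * l ∣ Nat.fib (m + 1) ^ 2 := sq (Nat.fib (m + 1)) ▸ mul_dvd_mul hk hl
  exact ((fib_succ_mul_modEq k m).dvd_iff hsq).2 ((mul_dvd_mul_left _ hl).mul_right _)

theorem exists_dvd_fib {n : ℕ} (hn : n ≠ 0) : ∃ d, 0 < d ∧ n ∣ Nat.fib d := by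
  induction n using induction_on_primes with
  | zero => exact absurd rfl hn
  | one => exact ⟨1, one_pos, one_dvd _⟩
  | prime_mul p n hp ih =>
    obtain ⟨d, hd, hnd⟩ := ih (right_ne_zero_of_mul hn)
    obtain ⟨c, hc, hpc⟩ : ∃ c, 0 < c ∧ p ∣ Nat.fib c := by
      by_cases h5 : p = 5
      · exact ⟨5, by simp, by rw [h5]; decide⟩
      · rcases prime_dvd_fib_pred_or_succ hp h5 with h | h
        · exact ⟨p - 1, Nat.sub_pos_of_lt hp.one_lt, h⟩
        · exact ⟨p + 1, p.succ_pos, h⟩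
    exact ⟨p * (c * d), Nat.mul_pos hp.pos (Nat.mul_pos hc hd), mul_dvd_fib_mul
      (hpc.trans (Nat.fib_dvd _ _ (dvd_mul_right c d)))
      (hnd.trans (Nat.fib_dvd _ _ (dvd_mul_left d c)))⟩

/-- The rank of apparition of `n`, the least `d > 0` with `n ∣ F_d`. As no such `d` exists for
`n = 0`, the convention `sInf ∅ = 0` gives `fibRank 0 = 0`. -/
noncomputable def fibRank (n : ℕ) : ℕ := sInf {d : ℕ | 0 < d ∧ n ∣ Nat.fib d}

theorem fibRank_spec {n : ℕ} (hn : n ≠ 0) : 0 < fibRank n ∧ n ∣ Nat.fib (fibRank n) :=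
  Nat.sInf_mem (exists_dvd_fib hn)

@[simp]
theorem fibRank_zero : fibRank 0 = 0 :=
  Nat.sInf_eq_zero.2 <| .inr <| Set.eq_empty_of_forall_notMem fun _ ⟨hd, h⟩ ↦
    hd.ne' (Nat.fib_eq_zero.1 (zero_dvd_iff.1 h))

theorem fibRank_ne_zero {n : ℕ} (hn : n ≠ 0) : fibRank n ≠ 0 := (fibRank_spec hn).1.ne'

theorem dvd_fib_iff_fibRank_dvd {n m : ℕ} : n ∣ Nat.fib m ↔ fibRank n ∣ m := by
  rcases eq_or_ne n 0 with rfl | hn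
  · simp
  obtain ⟨hpos, hdvd⟩ := fibRank_spec hn
  refine ⟨fun h ↦ ?_, fun h ↦ hdvd.trans (Nat.fib_dvd _ _ h)⟩
  have hle : fibRank n ≤ (fibRank n).gcd m :=
    Nat.sInf_le ⟨Nat.gcd_pos_of_pos_left _ hpos, Nat.fib_gcd _ _ ▸ Nat.dvd_gcd hdvd h⟩
  exact Nat.gcd_eq_left_iff_dvd.1 ((Nat.gcd_le_left _ hpos).antisymm hle)

theorem dvd_fib_fibRank (n : ℕ) : n ∣ Nat.fib (fibRank n) := dvd_fib_iff_fibRank_dvd.2 dvd_rfl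

theorem fibRank_dvd_fibRank {m n : ℕ} (h : m ∣ n) : fibRank m ∣ fibRank n :=
  dvd_fib_iff_fibRank_dvd.1 (h.trans (dvd_fib_fibRank n))

theorem fibRank_lcm (m n : ℕ) : fibRank (m.lcm n) = (fibRank m).lcm (fibRank n) :=
  Nat.dvd_antisymm
    (dvd_fib_iff_fibRank_dvd.1 (Nat.lcm_dvd (dvd_fib_iff_fibRank_dvd.2 (Nat.dvd_lcm_left _ _))
      (dvd_fib_iff_fibRank_dvd.2 (Nat.dvd_lcm_right _ _))))
    (Nat.lcm_dvd (fibRank_dvd_fibRank (Nat.dvd_lcm_left _ _))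
      (fibRank_dvd_fibRank (Nat.dvd_lcm_right _ _)))

theorem fibRank_prime_dvd {q : ℕ} (hq : q.Prime) (h5 : q ≠ 5) :
    fibRank q ∣ q - 1 ∨ fibRank q ∣ q + 1 :=
  (prime_dvd_fib_pred_or_succ hq h5).imp dvd_fib_iff_fibRank_dvd.1 dvd_fib_iff_fibRank_dvd.1

theorem fibRank_pow_succ_dvd (n b : ℕ) : fibRank (n ^ (b + 1)) ∣ n ^ b * fibRank n := by
  suffices n ^ (b + 1) ∣ Nat.fib (n ^ b * fibRank n) from dvd_fib_iff_fibRank_dvd.1 this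
  induction b with
  | zero => simpa using dvd_fib_fibRank n
  | succ b ih =>
    have hn : n ∣ Nat.fib (n ^ b * fibRank n) := (dvd_pow_self n b.succ_ne_zero).trans ih
    simpa only [pow_succ', mul_assoc] using mul_dvd_fib_mul hn ih

theorem lt_of_prime_dvd_fibRank {p q : ℕ} (hp : p.Prime) (hq : q.Prime) (h5 : 5 < p)
    (h : p ∣ fibRank q) : p < q := by
  have hq5 : q ≠ 5 := by
    rintro rfl
    have : fibRank 5 ∣ 5 := dvd_fib_iff_fibRank_dvd.1 (by decide)
    exact (Nat.le_of_dvd (by simp) (h.trans this)).not_gt h5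
  rcases fibRank_prime_dvd hq hq5 with hr | hr
  · exact (Nat.le_of_dvd (Nat.sub_pos_of_lt hq.one_lt) (h.trans hr)).trans_lt
      (Nat.sub_lt hq.pos one_pos)
  · have hpq : p ∣ q + 1 := h.trans hr
    have hne : p ≠ q + 1 := by
      rintro rfl
      have := hq.eq_two_or_odd'
      have := hp.eq_two_or_odd'
      grind
    have hne' : p ≠ q := by
      rintro rfl
      exact hp.one_lt.ne' (Nat.dvd_one.1 ((Nat.dvd_add_right dvd_rfl).1 hpq))
    have := Nat.le_of_dvd q.succ_pos hpq
    omega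

theorem pow_dvd_or_pow_dvd_of_pow_dvd_lcm {p a m n : ℕ} (hp : p.Prime) (h : p ^ a ∣ m.lcm n) :
    p ^ a ∣ m ∨ p ^ a ∣ n := by
  rcases eq_or_ne m 0 with rfl | hm
  · exact .inl (dvd_zero _)
  rcases eq_or_ne n 0 with rfl | hn
  · exact .inr (dvd_zero _)
  rw [hp.pow_dvd_iff_le_factorization (Nat.lcm_ne_zero hm hn), Nat.factorization_lcm hm hn] at h
  rw [hp.pow_dvd_iff_le_factorization hm, hp.pow_dvd_iff_le_factorization hn]
  exact le_sup_iff.1 h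

theorem exists_prime_pow_dvd_of_pow_dvd_fibRank {p a n : ℕ} (hp : p.Prime) (ha : a ≠ 0)
    (hn : n ≠ 0) (h : p ^ a ∣ fibRank n) :
    ∃ q b, q.Prime ∧ q ^ (b + 1) ∣ n ∧ p ^ a ∣ q ^ b * fibRank q := by
  induction n using Nat.recOnPosPrimePosCoprime with
  | zero => exact absurd rfl hn
  | one =>
    have hone : fibRank 1 ∣ 1 := dvd_fib_iff_fibRank_dvd.1 (one_dvd _)
    exact absurd (((dvd_pow_self p ha).trans h).trans hone) hp.not_dvd_one
  | prime_pow q b hq hb =>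
    obtain ⟨c, rfl⟩ := Nat.exists_eq_succ_of_ne_zero hb.ne'
    exact ⟨q, c, hq, dvd_rfl, h.trans (fibRank_pow_succ_dvd q c)⟩
  | coprime l m _ _ hlm ihl ihm =>
    rw [← hlm.lcm_eq_mul, fibRank_lcm] at h
    rcases pow_dvd_or_pow_dvd_of_pow_dvd_lcm hp h with h | h
    · obtain ⟨q, b, hq, hqb, hdvd⟩ := ihl (left_ne_zero_of_mul hn) h
      exact ⟨q, b, hq, hqb.mul_right _, hdvd⟩
    · obtain ⟨q, b, hq, hqb, hdvd⟩ := ihm (right_ne_zero_of_mul hn) h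
      exact ⟨q, b, hq, hqb.mul_left _, hdvd⟩

theorem exists_lt_prime_of_ordProj_dvd_fibRank {p n : ℕ} (hp : p.Prime) (h5 : 5 < p) (hn : n ≠ 0)
    (hpn : p ∣ n) (h : p ^ n.factorization p ∣ fibRank n) :
    ∃ q, q.Prime ∧ q ∣ n ∧ p < q ∧ p ^ n.factorization p ∣ fibRank q := by
  have hv : n.factorization p ≠ 0 := (hp.factorization_pos_of_dvd hn hpn).ne'
  obtain ⟨q, b, hq, hqn, hdvd⟩ := exists_prime_pow_dvd_of_pow_dvd_fibRank hp hv hn h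
  have hqp : q ≠ p := by
    rintro rfl
    have hcop : q.Coprime (fibRank q) :=
      hq.coprime_iff_not_dvd.2 fun hd ↦ (lt_of_prime_dvd_fibRank hq hq h5 hd).false
    have hle : n.factorization q ≤ b :=
      (Nat.pow_dvd_pow_iff_le_right hq.one_lt).1 ((hcop.pow_left _).dvd_of_dvd_mul_right hdvd)
    exact hle.not_gt ((hq.pow_dvd_iff_le_factorization hn).1 hqn)
  have hrank : p ^ n.factorization p ∣ fibRank q :=
    (((Nat.coprime_primes hp hq).2 hqp.symm).pow _ _).dvd_of_dvd_mul_left hdvd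
  exact ⟨q, hq, (dvd_pow_self q b.succ_ne_zero).trans hqn,
    lt_of_prime_dvd_fibRank hp hq h5 ((dvd_pow_self p hv).trans hrank), hrank⟩

theorem ordProj_dvd_of_dvd_mul_fibRank {k n n' p : ℕ} (hn : n ∣ k * fibRank n) (hk : k ∣ n')
    (hn' : fibRank n' ∣ n') (hp : p.Prime) (hpk : ¬ p ∣ 30 * k) :
    p ^ n.factorization p ∣ n' := by
  by_cases hpn : n ≠ 0 ∧ p ∣ n
  swap
  · have : n.factorization p = 0 := by
      rw [Nat.factorization_eq_zero_iff]; tauto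
    rw [this, pow_zero]
    exact one_dvd _
  have not_dvd_thirty : ∀ q, 5 < q → q.Prime → ¬ q ∣ 30 := fun q hlt hq hdvd ↦ by
    have : q ∣ 2 * 3 * 5 := hdvd
    simp only [hq.dvd_mul, Nat.prime_dvd_prime_iff_eq hq, Nat.prime_two, Nat.prime_three,
      Nat.prime_five] at this
    omega
  have h5 : 5 < p := by
    by_contra! hle
    refine hpk (dvd_mul_of_dvd_left ?_ k)
    interval_cases p <;> first | decide | exact absurd hp (by decide)
  have hcop : p.Coprime k := hp.coprime_iff_not_dvd.2 fun hd ↦ hpk (hd.mul_left _)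
  have hrank : p ^ n.factorization p ∣ fibRank n :=
    (hcop.pow_left _).dvd_of_dvd_mul_left ((Nat.ordProj_dvd n p).trans hn)
  obtain ⟨q, hq, hqn, hpq, hdvd⟩ :=
    exists_lt_prime_of_ordProj_dvd_fibRank hp h5 hpn.1 hpn.2 hrank
  have hqn' : q ∣ n' := by
    by_cases hqk : q ∣ 30 * k
    · exact (((hq.dvd_mul).1 hqk).resolve_left (not_dvd_thirty q (h5.trans hpq) hq)).trans hk
    · have : n - q < n - p := by have := Nat.le_of_dvd (by grind) hqn; omega
      exact (dvd_pow_self q (hq.factorization_pos_of_dvd hpn.1 hqn).ne').trans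
        (ordProj_dvd_of_dvd_mul_fibRank hn hk hn' hq hqk)
  exact hdvd.trans ((fibRank_dvd_fibRank hqn').trans hn')
termination_by n - p

theorem factorization_eq_of_mul_fibRank_eq {k n n' p : ℕ} (hn : n ≠ 0) (hn' : n' ≠ 0)
    (h : k * fibRank n = n) (h' : k * fibRank n' = n') (hp : p.Prime) (hpk : ¬ p ∣ 30 * k) :
    n.factorization p = n'.factorization p := by
  have le : ∀ {m m'}, m' ≠ 0 → k * fibRank m = m → k * fibRank m' = m' →
      m.factorization p ≤ m'.factorization p := fun {m m'} hm' h h' ↦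
    (hp.pow_dvd_iff_le_factorization hm').1 <| ordProj_dvd_of_dvd_mul_fibRank h.symm.dvd
      (Dvd.intro _ h') (Dvd.intro_left _ h') hp hpk
  exact (le hn' h h').antisymm (le hn h' h)

/-- The largest divisor of `n` all of whose prime factors lie in `s`. The empty factorization of
`0` makes it `1` for `n = 0`. -/
def factoredPart (s : Finset ℕ) (n : ℕ) : ℕ := (n.factorization.filter (· ∈ s)).prod (· ^ ·)

theorem filter_factorization_le (s : Finset ℕ) (n : ℕ) :
    n.factorization.filter (· ∈ s) ≤ n.factorization := fun p ↦ by
  rw [Finsupp.filter_apply]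
  split_ifs
  exacts [le_rfl, zero_le]

theorem factorization_factoredPart (s : Finset ℕ) (n : ℕ) :
    (factoredPart s n).factorization = n.factorization.filter (· ∈ s) :=
  Nat.factorization_prod_pow_eq_self_of_le_factorization (filter_factorization_le s n)

theorem factoredPart_dvd (s : Finset ℕ) (n : ℕ) : factoredPart s n ∣ n :=
  Nat.prod_pow_dvd_of_le_factorization (filter_factorization_le s n)

theorem factoredPart_mem_factoredNumbers (s : Finset ℕ) {n : ℕ} (hn : n ≠ 0) :
    factoredPart s n ∈ Nat.factoredNumbers s := by
  refine Nat.mem_factoredNumbers_of_primeFactors_subset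
    (ne_zero_of_dvd_ne_zero hn (factoredPart_dvd s n)) ?_
  rw [← Nat.support_factorization, factorization_factoredPart, Finsupp.support_filter]
  exact fun p hp ↦ (Finset.mem_filter.1 hp).2

theorem injOn_factoredPart {k : ℕ} (hk : k ≠ 0) :
    Set.InjOn (factoredPart (30 * k).primeFactors) {n | n ≠ 0 ∧ k * fibRank n = n} := by
  rintro n ⟨hn, hkn⟩ n' ⟨hn', hkn'⟩ h
  refine Nat.eq_of_factorization_eq hn hn' fun p ↦ ?_
  by_cases hp : p.Prime
  swap
  · simp only [Nat.factorization_eq_zero_of_not_prime _ hp]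
  by_cases hpk : p ∣ 30 * k
  · have hmem : p ∈ (30 * k).primeFactors := Nat.mem_primeFactors.2 ⟨hp, hpk, by omega⟩
    simpa only [factorization_factoredPart, Finsupp.filter_apply, if_pos hmem]
      using congrArg (fun m ↦ m.factorization p) h
  · exact factorization_eq_of_mul_fibRank_eq hn hn' hkn hkn' hp hpk

/-- The partial Euler product `∏_{p ∈ P} (1 - p⁻ˢ)⁻¹` of the zeta function. -/
noncomputable def eulerProd (P : Finset ℕ) (s : ℝ) : ℝ := ∏ p ∈ P, (1 - (p : ℝ) ^ (-s))⁻¹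

theorem one_le_inv_one_sub_rpow_neg {y s : ℝ} (hy : 1 < y) (hs : 0 < s) :
    1 ≤ (1 - y ^ (-s))⁻¹ := by
  have hlt : y ^ (-s) < 1 := Real.rpow_lt_one_of_one_lt_of_neg hy (neg_lt_zero.2 hs)
  have hnonneg : 0 ≤ y ^ (-s) := by positivity
  exact (one_le_inv₀ (sub_pos.2 hlt)).2 (sub_le_self _ hnonneg)

theorem eulerProd_nonneg {P : Finset ℕ} (hP : ∀ p ∈ P, p.Prime) {s : ℝ} (hs : 0 < s) :
    0 ≤ eulerProd P s :=
  Finset.prod_nonneg fun p hp ↦ zero_le_one.trans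
    (one_le_inv_one_sub_rpow_neg (Nat.one_lt_cast.2 (hP p hp).one_lt) hs)

theorem eulerProd_le_pow_card {P : Finset ℕ} {s y : ℝ} (hy : 1 < y) (hs : 0 < s)
    (hP : ∀ p ∈ P, y ≤ p) : eulerProd P s ≤ (1 - y ^ (-s))⁻¹ ^ P.card := by
  rw [← Finset.prod_const]
  refine Finset.prod_le_prod (fun p hp ↦ zero_le_one.trans
    (one_le_inv_one_sub_rpow_neg (hy.trans_le (hP p hp)) hs)) fun p hp ↦ ?_
  have hlt : y ^ (-s) < 1 := Real.rpow_lt_one_of_one_lt_of_neg hy (neg_lt_zero.2 hs)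
  have hle : (p : ℝ) ^ (-s) ≤ y ^ (-s) :=
    Real.rpow_le_rpow_of_nonpos (by positivity) (hP p hp) (neg_nonpos.2 hs.le)
  exact inv_anti₀ (sub_pos.2 hlt) (sub_le_sub_left hle 1)

theorem sum_rpow_neg_le_eulerProd {P T : Finset ℕ} (hP : ∀ p ∈ P, p.Prime) {s : ℝ} (hs : 0 < s)
    (hT : ∀ m ∈ T, m ∈ Nat.factoredNumbers P) :
    ∑ m ∈ T, (m : ℝ) ^ (-s) ≤ eulerProd P s := by
  let f : ℕ →* ℝ :=
    { toFun := fun n ↦ (n : ℝ) ^ (-s)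
      map_one' := by rw [Nat.cast_one, Real.one_rpow]
      map_mul' := fun m n ↦ by
        rw [Nat.cast_mul, Real.mul_rpow m.cast_nonneg n.cast_nonneg] }
  have hf : ∀ n, 0 ≤ f n := fun n ↦ Real.rpow_nonneg n.cast_nonneg _
  have hf_lt : ∀ {p : ℕ}, p.Prime → ‖f p‖ < 1 := fun {p} hp ↦ by
    rw [Real.norm_of_nonneg (hf p)]
    exact Real.rpow_lt_one_of_one_lt_of_neg (Nat.one_lt_cast.2 hp.one_lt) (neg_lt_zero.2 hs)
  have hsum : HasSum (fun m : Nat.factoredNumbers P ↦ f m) (eulerProd P s) := by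
    have := (EulerProduct.summable_and_hasSum_factoredNumbers_prod_filter_prime_geometric
      hf_lt P).2
    rwa [Finset.filter_true_of_mem hP] at this
  calc ∑ m ∈ T, f m = ∑ m ∈ T.subtype (· ∈ Nat.factoredNumbers P), f m := by
        rw [Finset.sum_subtype_of_mem f hT]
    _ ≤ eulerProd P s := sum_le_hasSum _ (fun m _ ↦ hf m) hsum

theorem card_le_rpow_mul_eulerProd {P T : Finset ℕ} (hP : ∀ p ∈ P, p.Prime) {s y : ℝ}
    (hs : 0 < s) (hy : 0 ≤ y) (hT : ∀ m ∈ T, m ∈ Nat.factoredNumbers P ∧ (m : ℝ) ≤ y) :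
    (T.card : ℝ) ≤ y ^ s * eulerProd P s := by
  -- Rankin's trick: each `m ≤ y` contributes `(y / m) ^ s ≥ 1`.
  have one_le : ∀ m ∈ T, 1 ≤ y ^ s * (m : ℝ) ^ (-s) := fun m hm ↦ by
    have hm0 : (0 : ℝ) < m :=
      Nat.cast_pos.2 (Nat.pos_of_ne_zero (Nat.ne_zero_of_mem_factoredNumbers (hT m hm).1))
    rw [Real.rpow_neg hm0.le, ← div_eq_mul_inv, one_le_div (by positivity)]
    exact Real.rpow_le_rpow hm0.le (hT m hm).2 hs.le
  calc (T.card : ℝ) = ∑ m ∈ T, 1 := by rw [Finset.sum_const, nsmul_one]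
    _ ≤ ∑ m ∈ T, y ^ s * (m : ℝ) ^ (-s) := Finset.sum_le_sum one_le
    _ = y ^ s * ∑ m ∈ T, (m : ℝ) ^ (-s) := (Finset.mul_sum ..).symm
    _ ≤ y ^ s * eulerProd P s := by
      gcongr
      exact sum_rpow_neg_le_eulerProd hP hs fun m hm ↦ (hT m hm).1

theorem eulerProd_le_exp {P : Finset ℕ} (hP : ∀ p ∈ P, 2 ≤ p) {s : ℝ} (hs : 1 / 2 ≤ s) :
    eulerProd P s ≤ Real.exp (4 * ∑ p ∈ P, (p : ℝ) ^ (-s)) := by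
  rw [Finset.mul_sum, Real.exp_sum]
  have hs0 : 0 < s := by linarith
  refine Finset.prod_le_prod (fun p hp ↦ zero_le_one.trans
    (one_le_inv_one_sub_rpow_neg (Nat.one_lt_cast.2 (hP p hp)) hs0)) fun p hp ↦ ?_
  have hp2 : (2 : ℝ) ≤ p := Nat.ofNat_le_cast.2 (hP p hp)
  have hle : (p : ℝ) ^ (-s) ≤ 3 / 4 := calc
    (p : ℝ) ^ (-s) ≤ 2 ^ (-s) :=
      Real.rpow_le_rpow_of_nonpos two_pos hp2 (by linarith)
    _ ≤ 2 ^ (-(1 / 2) : ℝ) := Real.rpow_le_rpow_of_exponent_le one_le_two (by linarith)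
    _ = (√2)⁻¹ := by rw [Real.rpow_neg two_pos.le, Real.sqrt_eq_rpow]
    _ ≤ (4 / 3)⁻¹ := inv_anti₀ (by norm_num) (Real.le_sqrt_of_sq_le (by norm_num))
    _ = 3 / 4 := by norm_num
  have hnonneg : 0 ≤ (p : ℝ) ^ (-s) := by positivity
  calc (1 - (p : ℝ) ^ (-s))⁻¹ ≤ 4 * (p : ℝ) ^ (-s) + 1 := by
        rw [inv_le_iff_one_le_mul₀ (by linarith)]
        nlinarith
    _ ≤ Real.exp (4 * (p : ℝ) ^ (-s)) := Real.add_one_le_exp _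

theorem pow_card_le_of_subset_primeFactors {n : ℕ} (hn : n ≠ 0) {T : Finset ℕ}
    (hT : T ⊆ n.primeFactors) {y : ℝ} (hy : 0 ≤ y) (hTy : ∀ p ∈ T, y ≤ p) : y ^ T.card ≤ n := by
  have hdvd : ∏ p ∈ T, p ∣ n :=
    (Finset.prod_dvd_prod_of_subset _ _ _ hT).trans (Nat.prod_primeFactors_dvd n)
  calc y ^ T.card = ∏ _ ∈ T, y := (Finset.prod_const y).symm
    _ ≤ ∏ p ∈ T, (p : ℝ) := Finset.prod_le_prod (fun _ _ ↦ hy) hTy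
    _ = (∏ p ∈ T, p : ℕ) := (Nat.cast_prod _ _).symm
    _ ≤ n := Nat.cast_le.2 (Nat.le_of_dvd (Nat.pos_of_ne_zero hn) hdvd)

theorem card_mul_log_le_of_subset_primeFactors {n : ℕ} (hn : n ≠ 0) {T : Finset ℕ}
    (hT : T ⊆ n.primeFactors) {y : ℝ} (hy : 0 < y) (hTy : ∀ p ∈ T, y ≤ p) :
    T.card * Real.log y ≤ Real.log n := by
  rw [← Real.log_pow]
  exact Real.log_le_log (by positivity) (pow_card_le_of_subset_primeFactors hn hT hy.le hTy)

theorem eulerProd_le_of_le_exp_inv {P : Finset ℕ} {s : ℝ} (hs : 0 < s) (hs1 : s ≤ 1)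
    (hP : ∀ p ∈ P, p.Prime ∧ (p : ℝ) ≤ Real.exp (1 / s)) :
    eulerProd P s ≤ (2 / s) ^ Real.exp (1 / s) := by
  have hcard : (P.card : ℝ) ≤ Real.exp (1 / s) := by
    have hsub : P ⊆ Finset.Icc 1 ⌊Real.exp (1 / s)⌋₊ := fun p hp ↦
      Finset.mem_Icc.2 ⟨(hP p hp).1.one_le, Nat.le_floor (hP p hp).2⟩
    rw [← Nat.le_floor_iff (by positivity)]
    simpa using Finset.card_le_card hsub
  have hfactor : (1 - (2 : ℝ) ^ (-s))⁻¹ ≤ 2 / s := by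
    have hbernoulli := rpow_one_add_le_one_add_mul_self
      (s := -(1 / 2)) (by norm_num) hs.le hs1
    rw [show (1 + -(1 / 2) : ℝ) = 2⁻¹ by norm_num, Real.inv_rpow two_pos.le,
      ← Real.rpow_neg two_pos.le] at hbernoulli
    rw [← inv_div]
    exact inv_anti₀ (by positivity) (by linarith)
  calc eulerProd P s ≤ (1 - (2 : ℝ) ^ (-s))⁻¹ ^ P.card :=
        eulerProd_le_pow_card one_lt_two hs fun p hp ↦ Nat.ofNat_le_cast.2 (hP p hp).1.two_le
    _ ≤ (2 / s) ^ P.card := by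
        gcongr
        exact zero_le_one.trans (one_le_inv_one_sub_rpow_neg one_lt_two hs)
    _ ≤ (2 / s) ^ Real.exp (1 / s) := by
        rw [← Real.rpow_natCast]
        exact Real.rpow_le_rpow_of_exponent_le ((one_le_div hs).2 (by linarith)) hcard

theorem eulerProd_le_rpow_of_exp_inv_le {n : ℕ} (hn : n ≠ 0) {P : Finset ℕ}
    (hPn : P ⊆ n.primeFactors) {s : ℝ} (hs : 0 < s) (hP : ∀ p ∈ P, Real.exp (1 / s) ≤ p) :
    eulerProd P s ≤ (n : ℝ) ^ s := by
  have hfactor : (1 - Real.exp (1 / s) ^ (-s))⁻¹ ≤ Real.exp 1 := by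
    rw [← Real.exp_mul, show 1 / s * -s = -1 by field_simp, Real.exp_neg,
      inv_le_iff_one_le_mul₀ (by linarith [inv_lt_one_of_one_lt₀ (Real.one_lt_exp_iff.2 one_pos)]),
      mul_one_sub, mul_inv_cancel₀ (Real.exp_ne_zero 1)]
    linarith [Real.add_one_le_exp 1]
  have hcard : (P.card : ℝ) ≤ Real.log n * s := by
    have := card_mul_log_le_of_subset_primeFactors hn hPn (Real.exp_pos _) hP
    rwa [Real.log_exp, mul_one_div, div_le_iff₀ hs] at this
  calc eulerProd P s ≤ (1 - Real.exp (1 / s) ^ (-s))⁻¹ ^ P.card :=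
        eulerProd_le_pow_card (Real.one_lt_exp_iff.2 (by positivity)) hs hP
    _ ≤ Real.exp 1 ^ P.card := by
        gcongr
        exact zero_le_one.trans
          (one_le_inv_one_sub_rpow_neg (Real.one_lt_exp_iff.2 (by positivity)) hs)
    _ = Real.exp P.card := by rw [← Real.exp_nat_mul, mul_one]
    _ ≤ Real.exp (Real.log n * s) := Real.exp_le_exp.2 hcard
    _ = (n : ℝ) ^ s := (Real.rpow_def_of_pos (Nat.cast_pos.2 (Nat.pos_of_ne_zero hn)) s).symm

theorem eulerProd_primeFactors_le {n : ℕ} (hn : n ≠ 0) {s : ℝ} (hs : 0 < s) (hs1 : s ≤ 1) :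
    eulerProd n.primeFactors s ≤ (2 / s) ^ Real.exp (1 / s) * (n : ℝ) ^ s := by
  let small : Finset ℕ := {p ∈ n.primeFactors | (p : ℝ) ≤ Real.exp (1 / s)}
  let large : Finset ℕ := {p ∈ n.primeFactors | ¬ (p : ℝ) ≤ Real.exp (1 / s)}
  have hlarge : ∀ p ∈ large, p.Prime := fun p hp ↦
    Nat.prime_of_mem_primeFactors (Finset.mem_of_mem_filter p hp)
  calc eulerProd n.primeFactors s = eulerProd small s * eulerProd large s :=
        (Finset.prod_filter_mul_prod_filter_not _ _ _).symm
    _ ≤ (2 / s) ^ Real.exp (1 / s) * (n : ℝ) ^ s := by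
        refine mul_le_mul ?_ ?_ (eulerProd_nonneg hlarge hs) (by positivity)
        · refine eulerProd_le_of_le_exp_inv hs hs1 fun p hp ↦ ?_
          exact (Finset.mem_filter.1 hp).imp_left Nat.prime_of_mem_primeFactors
        · refine eulerProd_le_rpow_of_exp_inv_le hn (Finset.filter_subset _ _) hs fun p hp ↦ ?_
          exact (not_le.1 (Finset.mem_filter.1 hp).2).le

theorem sum_le_sum_Icc_card {f : ℕ → ℝ} (hf : AntitoneOn f (Set.Ici 1)) {S : Finset ℕ}
    (hS : ∀ j ∈ S, 1 ≤ j) : ∑ j ∈ S, f j ≤ ∑ j ∈ Finset.Icc 1 S.card, f j := by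
  induction S using Finset.induction_on_max with
  | empty => simp
  | insert a S hlt ih =>
    have ha : a ∉ S := fun h ↦ (hlt a h).false
    have hcard : S.card + 1 ≤ a := by
      have hsub : S ⊆ Finset.Ico 1 a := fun j hj ↦
        Finset.mem_Ico.2 ⟨hS j (Finset.mem_insert_of_mem hj), hlt j hj⟩
      have hle := Finset.card_le_card hsub
      have h1 := hS a (Finset.mem_insert_self a S)
      rw [Nat.card_Ico] at hle
      omega
    rw [Finset.sum_insert ha, Finset.card_insert_of_notMem ha,
      Finset.sum_Icc_succ_top (Nat.le_add_left 1 _), add_comm]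
    exact add_le_add (ih fun j hj ↦ hS j (Finset.mem_insert_of_mem hj))
      (hf (Nat.le_add_left 1 _) (hS a (Finset.mem_insert_self a S)) hcard)

theorem sum_Icc_rpow_sub_one_le {η : ℝ} (h0 : 0 < η) (h1 : η ≤ 1) (n : ℕ) :
    ∑ j ∈ Finset.Icc 1 n, (j : ℝ) ^ (η - 1) ≤ (n : ℝ) ^ η / η := by
  induction n with
  | zero => simp [Real.zero_rpow h0.ne']
  | succ n ih =>
    have hn : (0 : ℝ) < (n + 1 : ℕ) := by positivity
    have hinv : ((n + 1 : ℕ) : ℝ)⁻¹ ≤ 1 := Nat.cast_inv_le_one _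
    have hstep : (n : ℝ) ^ η ≤ ((n + 1 : ℕ) : ℝ) ^ η - η * ((n + 1 : ℕ) : ℝ) ^ (η - 1) := calc
      (n : ℝ) ^ η = ((n + 1 : ℕ) : ℝ) ^ η * (1 + -((n + 1 : ℕ) : ℝ)⁻¹) ^ η := by
        rw [← Real.mul_rpow hn.le (by linarith), mul_add, mul_neg, mul_inv_cancel₀ hn.ne']
        push_cast; ring_nf
      _ ≤ ((n + 1 : ℕ) : ℝ) ^ η * (1 + η * -((n + 1 : ℕ) : ℝ)⁻¹) := by
        gcongr
        exact rpow_one_add_le_one_add_mul_self (by linarith) h0.le h1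
      _ = _ := by
        rw [Real.rpow_sub hn, Real.rpow_one]; ring
    rw [Finset.sum_Icc_succ_top (Nat.le_add_left 1 n)]
    rw [le_div_iff₀ h0] at ih ⊢
    linarith

theorem rpow_sub_one_le_mul_rpow_sub_one {x y C η : ℝ} (h0 : 0 ≤ η) (h1 : η ≤ 1) (hC : 1 ≤ C)
    (hy : 0 < y) (hyx : y ≤ C * x) : x ^ (η - 1) ≤ C * y ^ (η - 1) := by
  have hC0 : 0 < C := one_pos.trans_le hC
  calc x ^ (η - 1) ≤ (C⁻¹ * y) ^ (η - 1) :=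
        Real.rpow_le_rpow_of_nonpos (by positivity) ((inv_mul_le_iff₀ hC0).2 hyx) (by linarith)
    _ = C ^ (1 - η) * y ^ (η - 1) := by
        rw [Real.mul_rpow (by positivity) hy.le, Real.inv_rpow hC0.le, ← Real.rpow_neg hC0.le,
          neg_sub]
    _ ≤ C * y ^ (η - 1) := by
        gcongr
        exact Real.rpow_le_self_of_one_le hC (by linarith)

theorem sum_rpow_sub_one_le_of_mod_eq {η : ℝ} (h0 : 0 < η) (h1 : η ≤ 1) {e a : ℕ} {T : Finset ℕ}
    (hT : ∀ p ∈ T, 1 ≤ p ∧ e ≤ p + 1 ∧ p % e = a) (hcard : T.card ≤ e) :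
    ∑ p ∈ T, (p : ℝ) ^ (η - 1) ≤ 3 / η * (e : ℝ) ^ (2 * η - 1) := by
  rcases Nat.eq_zero_or_pos e with rfl | he
  · rw [Finset.card_eq_zero.1 (Nat.le_zero.1 hcard), Finset.sum_empty]
    positivity
  let index : ℕ → ℕ := fun p ↦ p / e + 1
  have index_injOn : Set.InjOn index T := fun p hp q hq h ↦ by
    rw [← Nat.div_add_mod p e, ← Nat.div_add_mod q e, (hT p hp).2.2, (hT q hq).2.2,
      Nat.succ_injective h]
  have hterm : ∀ p ∈ T, (p : ℝ) ^ (η - 1) ≤ 3 * (e : ℝ) ^ (η - 1) * (index p : ℝ) ^ (η - 1) := by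
    intro p hp
    obtain ⟨hp1, hep, -⟩ := hT p hp
    have hle : e * index p ≤ 3 * p := by
      have := Nat.mul_div_le p e
      simp only [index, mul_add_one]
      omega
    rw [mul_assoc, ← Real.mul_rpow (by positivity) (by positivity)]
    exact rpow_sub_one_le_mul_rpow_sub_one h0.le h1 (by norm_num) (by positivity)
      (by exact_mod_cast hle)
  have hanti : AntitoneOn (fun j : ℕ ↦ (j : ℝ) ^ (η - 1)) (Set.Ici 1) := fun i hi j _ hij ↦
    Real.rpow_le_rpow_of_nonpos (Nat.cast_pos.2 hi) (Nat.cast_le.2 hij) (by linarith)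
  calc ∑ p ∈ T, (p : ℝ) ^ (η - 1)
      ≤ ∑ p ∈ T, 3 * (e : ℝ) ^ (η - 1) * (index p : ℝ) ^ (η - 1) := Finset.sum_le_sum hterm
    _ = 3 * (e : ℝ) ^ (η - 1) * ∑ j ∈ T.image index, (j : ℝ) ^ (η - 1) := by
        rw [Finset.sum_image index_injOn, Finset.mul_sum]
    _ ≤ 3 * (e : ℝ) ^ (η - 1) * ((e : ℝ) ^ η / η) := by
        gcongr
        refine (sum_le_sum_Icc_card hanti ?_).trans ((sum_Icc_rpow_sub_one_le h0 h1 _).trans ?_)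
        · exact Finset.forall_mem_image.2 fun p _ ↦ Nat.le_add_left 1 _
        · gcongr
          exact Finset.card_image_le.trans hcard
    _ = 3 / η * (e : ℝ) ^ (2 * η - 1) := by
        rw [show 2 * η - 1 = η - 1 + η by ring, Real.rpow_add (by positivity)]
        ring

theorem fib_le_two_pow (n : ℕ) : Nat.fib n ≤ 2 ^ n := by
  induction n using Nat.twoStepInduction with
  | zero => simp
  | one => simp
  | more n h₁ h₂ => rw [pow_succ] at h₂; rw [Nat.fib_add_two, pow_succ, pow_succ]; omega

theorem card_le_of_fibRank_eq {e : ℕ} {T : Finset ℕ} (hT : ∀ p ∈ T, p.Prime ∧ fibRank p = e) :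
    T.card ≤ e := by
  rcases T.eq_empty_or_nonempty with rfl | ⟨q, hq⟩
  · exact Nat.zero_le e
  have hfib : Nat.fib e ≠ 0 := by
    rw [Ne, Nat.fib_eq_zero, ← (hT q hq).2]
    exact fibRank_ne_zero (hT q hq).1.ne_zero
  have hsub : T ⊆ (Nat.fib e).primeFactors := fun p hp ↦ Nat.mem_primeFactors.2
    ⟨(hT p hp).1, dvd_fib_iff_fibRank_dvd.2 (hT p hp).2.dvd, hfib⟩
  have hpow : ((2 : ℝ)) ^ T.card ≤ 2 ^ e :=
    (pow_card_le_of_subset_primeFactors hfib hsub two_pos.le fun p hp ↦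
      Nat.ofNat_le_cast.2 (hT p hp).1.two_le).trans (by exact_mod_cast fib_le_two_pow e)
  exact (pow_le_pow_iff_right₀ one_lt_two).1 hpow

theorem fibRank_prime_le {q : ℕ} (hq : q.Prime) : fibRank q ≤ q + 1 := by
  by_cases h5 : q = 5
  · have : fibRank 5 ∣ 5 := dvd_fib_iff_fibRank_dvd.1 (by decide)
    exact h5 ▸ (Nat.le_of_dvd (by simp) this).trans (Nat.le_succ _)
  rcases fibRank_prime_dvd hq h5 with h | h
  · exact (Nat.le_of_dvd (Nat.sub_pos_of_lt hq.one_lt) h).trans (by omega)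
  · exact Nat.le_of_dvd q.succ_pos h

theorem mod_fibRank_mem {q : ℕ} (hq : q.Prime) :
    q % fibRank q ∈ ({0, 1 % fibRank q, fibRank q - 1} : Finset ℕ) := by
  simp only [Finset.mem_insert, Finset.mem_singleton]
  by_cases h5 : q = 5
  · subst h5
    exact .inl (Nat.mod_eq_zero_of_dvd (dvd_fib_iff_fibRank_dvd.1 (by decide)))
  refine .inr ((fibRank_prime_dvd hq h5).imp (fun h ↦ ?_) fun h ↦ ?_)
  · exact ((Nat.modEq_iff_dvd' hq.one_le).2 h).symm
  · have hsucc : q + 1 ≡ fibRank q - 1 + 1 [MOD fibRank q] := by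
      rw [Nat.sub_add_cancel (fibRank_spec hq.ne_zero).1]
      exact (Nat.modEq_zero_iff_dvd.2 h).trans (Nat.modEq_zero_iff_dvd.2 dvd_rfl).symm
    exact Eq.trans (hsucc.add_right_cancel' 1)
      (Nat.mod_eq_of_lt (Nat.sub_one_lt (fibRank_ne_zero hq.ne_zero)))

theorem sum_rpow_sub_one_le_of_fibRank_eq {η : ℝ} (h0 : 0 < η) (h1 : η ≤ 1) {e : ℕ}
    {T : Finset ℕ} (hT : ∀ p ∈ T, p.Prime ∧ fibRank p = e) :
    ∑ p ∈ T, (p : ℝ) ^ (η - 1) ≤ 9 / η * (e : ℝ) ^ (2 * η - 1) := by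
  let residues : Finset ℕ := {0, 1 % e, e - 1}
  have hresidues : ∀ p ∈ T, p % e ∈ residues := fun p hp ↦ by
    have hmem := mod_fibRank_mem (hT p hp).1
    rwa [(hT p hp).2] at hmem
  have hclass : ∀ a ∈ residues,
      ∑ p ∈ T with p % e = a, (p : ℝ) ^ (η - 1) ≤ 3 / η * (e : ℝ) ^ (2 * η - 1) := by
    refine fun a _ ↦ sum_rpow_sub_one_le_of_mod_eq (a := a) h0 h1 (fun p hp ↦ ?_)
      ((Finset.card_filter_le _ _).trans (card_le_of_fibRank_eq hT))
    obtain ⟨hp, hpa⟩ := Finset.mem_filter.1 hp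
    exact ⟨(hT p hp).1.one_le, (hT p hp).2 ▸ fibRank_prime_le (hT p hp).1, hpa⟩
  calc ∑ p ∈ T, (p : ℝ) ^ (η - 1)
      = ∑ a ∈ residues, ∑ p ∈ T with p % e = a, (p : ℝ) ^ (η - 1) :=
        (Finset.sum_fiberwise_of_maps_to hresidues _).symm
    _ ≤ residues.card • (3 / η * (e : ℝ) ^ (2 * η - 1)) := Finset.sum_le_card_nsmul _ _ _ hclass
    _ ≤ 3 * (3 / η * (e : ℝ) ^ (2 * η - 1)) := by
        rw [nsmul_eq_mul]
        gcongr
        exact_mod_cast Finset.card_le_three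
    _ = 9 / η * (e : ℝ) ^ (2 * η - 1) := by ring

theorem sum_primeFactors_fib_rpow_le {η : ℝ} (h0 : 0 < η) (h1 : η ≤ 1) {d : ℕ} (hd : d ≠ 0) :
    ∑ p ∈ (Nat.fib d).primeFactors, (p : ℝ) ^ (η - 1) ≤
      9 / η * ∑ e ∈ d.divisors, (e : ℝ) ^ (2 * η - 1) := by
  have hrank : ∀ p ∈ (Nat.fib d).primeFactors, fibRank p ∈ d.divisors := fun p hp ↦
    Nat.mem_divisors.2 ⟨dvd_fib_iff_fibRank_dvd.1 (Nat.dvd_of_mem_primeFactors hp), hd⟩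
  rw [← Finset.sum_fiberwise_of_maps_to hrank, Finset.mul_sum]
  refine Finset.sum_le_sum fun e _ ↦ sum_rpow_sub_one_le_of_fibRank_eq h0 h1 fun p hp ↦ ?_
  exact (Finset.mem_filter.1 hp).imp_left Nat.prime_of_mem_primeFactors

theorem sum_divisors_rpow_neg_le {s : ℝ} (hs : 0 < s) {d : ℕ} :
    ∑ e ∈ d.divisors, (e : ℝ) ^ (-s) ≤ eulerProd d.primeFactors s := by
  refine sum_rpow_neg_le_eulerProd (fun p ↦ Nat.prime_of_mem_primeFactors) hs fun e he ↦ ?_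
  obtain ⟨hdvd, hd⟩ := Nat.mem_divisors.1 he
  exact Nat.mem_factoredNumbers_of_primeFactors_subset (ne_zero_of_dvd_ne_zero hd hdvd)
    (Nat.primeFactors_mono hdvd hd)

theorem sum_inv_primes_Ico_two_pow_le {i : ℕ} (hi : i ≠ 0) :
    ∑ p ∈ Finset.Ico (2 ^ i : ℕ) (2 ^ (i + 1)) with p.Prime, (p : ℝ)⁻¹ ≤ 4 / i := by
  have : (0 : ℝ) < i := Nat.cast_pos.2 (Nat.pos_of_ne_zero hi)
  have : 0 < Real.log 2 := Real.log_pos one_lt_two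
  have hterm : ∀ p ∈ Finset.Ico (2 ^ i : ℕ) (2 ^ (i + 1)), (p : ℝ)⁻¹ ≤
      Real.log p / (2 ^ i * (i * Real.log 2)) := fun p hp ↦ by
    have hle : (2 : ℝ) ^ i ≤ p := by exact_mod_cast (Finset.mem_Ico.1 hp).1
    have hp0 : (0 : ℝ) < p := (by positivity : (0 : ℝ) < 2 ^ i).trans_le hle
    have hlog : i * Real.log 2 ≤ Real.log p := by
      rw [← Real.log_pow]
      gcongr
    rw [inv_eq_one_div, div_le_div_iff₀ hp0 (by positivity), one_mul, mul_comm (Real.log _)]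
    gcongr
  have htheta : ∑ p ∈ Finset.Ico (2 ^ i : ℕ) (2 ^ (i + 1)) with p.Prime, Real.log p ≤
      Real.log 4 * 2 ^ (i + 1) := by
    refine le_trans ?_ (Chebyshev.theta_le_log4_mul_x (x := 2 ^ (i + 1)) (by positivity))
    rw [Chebyshev.theta_eq_sum_Icc]
    refine Finset.sum_le_sum_of_subset_of_nonneg (Finset.filter_subset_filter _ fun p hp ↦ ?_)
      fun p _ _ ↦ Real.log_natCast_nonneg p
    exact Finset.mem_Icc.2 ⟨Nat.zero_le p,
      Nat.le_floor (by exact_mod_cast (Finset.mem_Ico.1 hp).2.le)⟩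
  calc ∑ p ∈ Finset.Ico (2 ^ i : ℕ) (2 ^ (i + 1)) with p.Prime, (p : ℝ)⁻¹
      ≤ (∑ p ∈ Finset.Ico (2 ^ i : ℕ) (2 ^ (i + 1)) with p.Prime, Real.log p) /
          (2 ^ i * (i * Real.log 2)) := by
        rw [Finset.sum_div]
        exact Finset.sum_le_sum fun p hp ↦ hterm p (Finset.mem_of_mem_filter p hp)
    _ ≤ Real.log 4 * 2 ^ (i + 1) / (2 ^ i * (i * Real.log 2)) := by gcongr
    _ = 4 / i := by
        rw [show (4 : ℝ) = 2 ^ 2 by norm_num, Real.log_pow, pow_succ]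
        field_simp
        norm_num

theorem sum_inv_primes_range_two_pow_le (m : ℕ) :
    ∑ p ∈ Finset.range (2 ^ (m + 1)) with p.Prime, (p : ℝ)⁻¹ ≤ 4 * harmonic m := by
  induction m with
  | zero =>
    have hempty : Finset.filter Nat.Prime (Finset.range (2 ^ (0 + 1))) = ∅ := by decide
    rw [hempty]
    simp
  | succ m ih =>
    rw [Finset.sum_filter, ← Finset.sum_range_add_sum_Ico _
      (Nat.pow_le_pow_right two_pos (Nat.le_succ (m + 1))), ← Finset.sum_filter,
      ← Finset.sum_filter, harmonic_succ]
    have hdyadic := sum_inv_primes_Ico_two_pow_le m.succ_ne_zero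
    push_cast [div_eq_mul_inv] at hdyadic ⊢
    linarith

theorem sum_inv_primes_le {Y : ℝ} (hY : Real.exp 1 ≤ Y) :
    ∑ p ∈ Finset.range (⌊Y⌋₊ + 1) with p.Prime, (p : ℝ)⁻¹ ≤
      4 * (2 + Real.log (Real.log Y)) := by
  have hY2 : 2 ≤ Y := one_add_one_eq_two.symm.trans_le ((Real.add_one_le_exp 1).trans hY)
  have hlogY : 1 ≤ Real.log Y := (Real.le_log_iff_exp_le (by linarith)).2 hY
  have hfloor : 2 ≤ ⌊Y⌋₊ := Nat.le_floor hY2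
  set m := Nat.log 2 ⌊Y⌋₊
  have hm : (0 : ℝ) < m := Nat.cast_pos.2 (Nat.log_pos one_lt_two hfloor)
  have hm_le : (m : ℝ) ≤ Real.exp 1 * Real.log Y := by
    have hpow : (2 : ℝ) ^ m ≤ Y := calc
      (2 : ℝ) ^ m ≤ ⌊Y⌋₊ := by exact_mod_cast Nat.pow_log_le_self 2 (by omega)
      _ ≤ Y := Nat.floor_le (by linarith)
    have hlog := Real.log_le_log (by positivity) hpow
    rw [Real.log_pow] at hlog
    nlinarith [Real.log_two_gt_d9, Real.exp_one_gt_d9]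
  calc ∑ p ∈ Finset.range (⌊Y⌋₊ + 1) with p.Prime, (p : ℝ)⁻¹
      ≤ ∑ p ∈ Finset.range (2 ^ (m + 1)) with p.Prime, (p : ℝ)⁻¹ := by
        refine Finset.sum_le_sum_of_subset_of_nonneg (Finset.filter_subset_filter _
          (Finset.range_subset_range.2 ?_)) fun _ _ _ ↦ by positivity
        exact Nat.lt_pow_succ_log_self one_lt_two _
    _ ≤ 4 * (1 + Real.log m) := (sum_inv_primes_range_two_pow_le m).trans
        (mul_le_mul_of_nonneg_left (harmonic_le_one_add_log m) zero_le_four)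
    _ ≤ 4 * (1 + Real.log (Real.exp 1 * Real.log Y)) := by gcongr
    _ = 4 * (2 + Real.log (Real.log Y)) := by
        rw [Real.log_mul (Real.exp_ne_zero 1) (by linarith), Real.log_exp]
        ring

theorem sum_rpow_sub_one_le_of_subset_primeFactors {σ Y : ℝ} (h1 : σ ≤ 1) (hY : Real.exp 1 ≤ Y)
    {d : ℕ} (hd : d ≠ 0) (hdY : Real.log d ≤ Y) {T : Finset ℕ} (hT : T ⊆ d.primeFactors)
    (hTY : ∀ p ∈ T, Y ≤ p) : ∑ p ∈ T, (p : ℝ) ^ (σ - 1) ≤ Y ^ σ := by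
  have hY0 : 0 < Y := (Real.exp_pos 1).trans_le hY
  have hlogY : 1 ≤ Real.log Y := (Real.le_log_iff_exp_le hY0).2 hY
  have hcard : (T.card : ℝ) ≤ Y := calc
    (T.card : ℝ) ≤ T.card * Real.log Y := le_mul_of_one_le_right T.card.cast_nonneg hlogY
    _ ≤ Y := (card_mul_log_le_of_subset_primeFactors hd hT hY0 hTY).trans hdY
  calc ∑ p ∈ T, (p : ℝ) ^ (σ - 1) ≤ T.card • Y ^ (σ - 1) :=
        Finset.sum_le_card_nsmul _ _ _ fun p hp ↦
          Real.rpow_le_rpow_of_nonpos hY0 (hTY p hp) (by linarith)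
    _ ≤ Y * Y ^ (σ - 1) := by
        rw [nsmul_eq_mul]
        gcongr
    _ = Y ^ σ := by rw [Real.rpow_sub_one hY0.ne', mul_div_cancel₀ _ hY0.ne']

theorem sum_primeFactors_rpow_sub_one_le {σ Y : ℝ} (h0 : 0 ≤ σ) (h1 : σ ≤ 1)
    (hY : Real.exp 1 ≤ Y) {d : ℕ} (hd : d ≠ 0) (hdY : Real.log d ≤ Y) :
    ∑ p ∈ d.primeFactors, (p : ℝ) ^ (σ - 1) ≤ Y ^ σ * (9 + 4 * Real.log (Real.log Y)) := by
  have hY0 : 0 < Y := (Real.exp_pos 1).trans_le hY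
  have hsmall : ∑ p ∈ d.primeFactors with p ≤ ⌊Y⌋₊, (p : ℝ) ^ (σ - 1) ≤
      Y ^ σ * (4 * (2 + Real.log (Real.log Y))) := calc
    _ ≤ ∑ p ∈ d.primeFactors with p ≤ ⌊Y⌋₊, Y ^ σ * (p : ℝ)⁻¹ := by
        refine Finset.sum_le_sum fun p hp ↦ ?_
        obtain ⟨hp, hpY⟩ := Finset.mem_filter.1 hp
        rw [Real.rpow_sub (Nat.cast_pos.2 (Nat.pos_of_mem_primeFactors hp)), Real.rpow_one,
          div_eq_mul_inv]
        gcongr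
        exact (Nat.le_floor_iff hY0.le).1 hpY
    _ = Y ^ σ * ∑ p ∈ d.primeFactors with p ≤ ⌊Y⌋₊, (p : ℝ)⁻¹ := (Finset.mul_sum ..).symm
    _ ≤ Y ^ σ * ∑ p ∈ Finset.range (⌊Y⌋₊ + 1) with p.Prime, (p : ℝ)⁻¹ := by
        refine mul_le_mul_of_nonneg_left (Finset.sum_le_sum_of_subset_of_nonneg (fun p hp ↦ ?_)
          fun _ _ _ ↦ by positivity) (by positivity)
        obtain ⟨hp, hpY⟩ := Finset.mem_filter.1 hp
        exact Finset.mem_filter.2 ⟨Finset.mem_range_succ_iff.2 hpY,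
          Nat.prime_of_mem_primeFactors hp⟩
    _ ≤ _ := by gcongr; exact sum_inv_primes_le hY
  have hlarge : ∑ p ∈ d.primeFactors with ¬ p ≤ ⌊Y⌋₊, (p : ℝ) ^ (σ - 1) ≤ Y ^ σ := by
    refine sum_rpow_sub_one_le_of_subset_primeFactors h1 hY hd hdY (Finset.filter_subset _ _)
      fun p hp ↦ ?_
    exact (Nat.lt_of_floor_lt (not_le.1 (Finset.mem_filter.1 hp).2)).le
  rw [← Finset.sum_filter_add_sum_filter_not d.primeFactors (· ≤ ⌊Y⌋₊)]
  linarith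

/-- An upper bound for the logarithm of the Euler product at `1 - η` over the prime factors of
`F_d`, valid for every `d` with `log d ≤ Y`. -/
noncomputable def fibEulerBound (η Y : ℝ) : ℝ :=
  36 / η * Real.exp (4 * (Y ^ (2 * η) * (9 + 4 * Real.log (Real.log Y))))

theorem eulerProd_primeFactors_fib_le {η Y : ℝ} (h0 : 0 < η) (h1 : η ≤ 1 / 4)
    (hY : Real.exp 1 ≤ Y) {d : ℕ} (hd : d ≠ 0) (hdY : Real.log d ≤ Y) :
    eulerProd (Nat.fib d).primeFactors (1 - η) ≤ Real.exp (fibEulerBound η Y) := by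
  have hfactors : ∀ n : ℕ, ∀ p ∈ n.primeFactors, 2 ≤ p := fun n p hp ↦
    (Nat.prime_of_mem_primeFactors hp).two_le
  have hdivisors : ∑ e ∈ d.divisors, (e : ℝ) ^ (2 * η - 1) ≤
      Real.exp (4 * (Y ^ (2 * η) * (9 + 4 * Real.log (Real.log Y)))) := calc
    _ ≤ eulerProd d.primeFactors (1 - 2 * η) := by
        rw [← neg_sub 1 (2 * η)]
        exact sum_divisors_rpow_neg_le (by linarith)
    _ ≤ Real.exp (4 * ∑ p ∈ d.primeFactors, (p : ℝ) ^ (2 * η - 1)) := by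
        rw [← neg_sub 1 (2 * η)]
        exact eulerProd_le_exp (hfactors d) (by linarith)
    _ ≤ _ := by
        gcongr
        exact sum_primeFactors_rpow_sub_one_le (by linarith) (by linarith) hY hd hdY
  calc eulerProd (Nat.fib d).primeFactors (1 - η)
      ≤ Real.exp (4 * ∑ p ∈ (Nat.fib d).primeFactors, (p : ℝ) ^ (η - 1)) := by
        rw [← neg_sub 1 η]
        exact eulerProd_le_exp (hfactors _) (by linarith)
    _ ≤ Real.exp (4 * (9 / η * ∑ e ∈ d.divisors, (e : ℝ) ^ (2 * η - 1))) := by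
        gcongr
        exact sum_primeFactors_fib_rpow_le h0 (by linarith) hd
    _ = Real.exp (36 / η * ∑ e ∈ d.divisors, (e : ℝ) ^ (2 * η - 1)) := by ring_nf
    _ ≤ Real.exp (fibEulerBound η Y) := by
        rw [fibEulerBound]
        gcongr

/-- The self-Fibonacci divisors up to `x`, as a finset, so that they can be split according to
their rank of apparition. -/
noncomputable def selfFibFinset (x : ℝ) : Finset ℕ := {n ∈ Finset.Icc 1 ⌊x⌋₊ | n ∣ Nat.fib n}

theorem mem_selfFibFinset {x : ℝ} {n : ℕ} :
    n ∈ selfFibFinset x ↔ n ≠ 0 ∧ fibRank n ∣ n ∧ (n : ℝ) ≤ x := by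
  rw [selfFibFinset, Finset.mem_filter, Finset.mem_Icc, Nat.one_le_iff_ne_zero,
    dvd_fib_iff_fibRank_dvd, and_assoc]
  exact and_congr_right fun hn ↦ by rw [Nat.le_floor_iff' hn, and_comm]

theorem selfFibCount_eq_card (x : ℝ) : selfFibCount x = (selfFibFinset x).card := by
  rw [selfFibCount, ← Set.ncard_coe_finset]
  congr 1
  ext n
  simp only [selfFibDivisors, Set.mem_ofPred_eq, Finset.mem_coe, mem_selfFibFinset,
    Nat.pos_iff_ne_zero, dvd_fib_iff_fibRank_dvd, and_assoc]

theorem one_le_selfFibCount {x : ℝ} (hx : 1 ≤ x) : 1 ≤ selfFibCount x := by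
  rw [selfFibCount_eq_card, Finset.one_le_card]
  exact ⟨1, mem_selfFibFinset.2 ⟨one_ne_zero, dvd_fib_iff_fibRank_dvd.1 (one_dvd _), by simpa⟩⟩

theorem card_le_of_mul_fibRank_eq {k : ℕ} (hk : k ≠ 0) {s y : ℝ} (hs : 0 < s) (hy : 0 ≤ y)
    {T : Finset ℕ} (hT : ∀ n ∈ T, n ≠ 0 ∧ k * fibRank n = n ∧ (n : ℝ) ≤ y) :
    (T.card : ℝ) ≤ y ^ s * eulerProd (30 * k).primeFactors s := by
  have hinj : Set.InjOn (factoredPart (30 * k).primeFactors) T :=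
    (injOn_factoredPart hk).mono fun n hn ↦ (hT n hn).imp_right And.left
  rw [← Finset.card_image_of_injOn hinj]
  refine card_le_rpow_mul_eulerProd (fun p ↦ Nat.prime_of_mem_primeFactors) hs hy
    (Finset.forall_mem_image.2 fun n hn ↦ ?_)
  obtain ⟨hn0, -, hny⟩ := hT n hn
  have hle := Nat.le_of_dvd (Nat.pos_of_ne_zero hn0) (factoredPart_dvd (30 * k).primeFactors n)
  exact ⟨factoredPart_mem_factoredNumbers _ hn0, (Nat.cast_le.2 hle).trans hny⟩

theorem card_le_of_dvd_fib {d : ℕ} (hd : d ≠ 0) {s y : ℝ} (hs : 0 < s) (hy : 0 ≤ y)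
    {T : Finset ℕ} (hT : ∀ n ∈ T, d ∣ n ∧ n ∣ Nat.fib d ∧ (n : ℝ) ≤ y) :
    (T.card : ℝ) ≤ (y / d) ^ s * eulerProd (Nat.fib d).primeFactors s := by
  have hfib : Nat.fib d ≠ 0 := Nat.fib_eq_zero.not.2 hd
  have hinj : Set.InjOn (· / d) (T : Set ℕ) := fun n hn n' hn' h ↦
    (Nat.div_left_inj (hT n hn).1 (hT n' hn').1).1 h
  rw [← Finset.card_image_of_injOn hinj]
  refine card_le_rpow_mul_eulerProd (fun p ↦ Nat.prime_of_mem_primeFactors) hs (by positivity)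
    (Finset.forall_mem_image.2 fun n hn ↦ ?_)
  obtain ⟨hdn, hnd, hny⟩ := hT n hn
  have hdvd : n / d ∣ Nat.fib d := (Nat.div_dvd_of_dvd hdn).trans hnd
  refine ⟨Nat.mem_factoredNumbers_of_primeFactors_subset (ne_zero_of_dvd_ne_zero hfib hdvd)
    (Nat.primeFactors_mono hdvd hfib), ?_⟩
  rw [Nat.cast_div hdn (Nat.cast_ne_zero.2 hd)]
  gcongr

theorem card_filter_lt_fibRank_le {x D s : ℝ} (hx : 0 ≤ x) (hD : 1 ≤ D) (hs0 : 0 < s)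
    (hs1 : s ≤ 1) :
    (Finset.card {n ∈ selfFibFinset x | D < fibRank n} : ℝ) ≤
      x / D * (x ^ s * ((2 / s) ^ Real.exp (1 / s) * (30 * x) ^ s)) := by
  set S : Finset ℕ := {n ∈ selfFibFinset x | D < fibRank n}
  have hS : ∀ n ∈ S, (n ≠ 0 ∧ fibRank n ∣ n ∧ (n : ℝ) ≤ x) ∧ D < fibRank n := fun n hn ↦
    (Finset.mem_filter.1 hn).imp_left mem_selfFibFinset.1
  have hcofactor : ∀ n ∈ S, n / fibRank n ∈ Finset.Icc 1 ⌊x / D⌋₊ := fun n hn ↦ by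
    obtain ⟨⟨hn0, hdvd, hnx⟩, hDn⟩ := hS n hn
    have hrank := fibRank_ne_zero hn0
    refine Finset.mem_Icc.2 ⟨Nat.div_pos (Nat.le_of_dvd (Nat.pos_of_ne_zero hn0) hdvd)
      (Nat.pos_of_ne_zero hrank), Nat.le_floor ?_⟩
    rw [Nat.cast_div hdvd (Nat.cast_ne_zero.2 hrank)]
    gcongr
  have hfiber : ∀ k ∈ Finset.Icc 1 ⌊x / D⌋₊, (Finset.card {n ∈ S | n / fibRank n = k} : ℝ) ≤
      x ^ s * ((2 / s) ^ Real.exp (1 / s) * (30 * x) ^ s) := fun k hk ↦ by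
    obtain ⟨hk1, hkx⟩ := Finset.mem_Icc.1 hk
    have hk0 : k ≠ 0 := Nat.one_le_iff_ne_zero.1 hk1
    have hkx : (k : ℝ) ≤ x := ((Nat.le_floor_iff' hk0).1 hkx).trans (div_le_self hx hD)
    refine (card_le_of_mul_fibRank_eq hk0 hs0 hx fun n hn ↦ ?_).trans ?_
    · obtain ⟨hnS, rfl⟩ := Finset.mem_filter.1 hn
      obtain ⟨⟨hn0, hdvd, hnx⟩, -⟩ := hS n hnS
      exact ⟨hn0, Nat.div_mul_cancel hdvd, hnx⟩
    · gcongr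
      refine (eulerProd_primeFactors_le (by positivity) hs0 hs1).trans ?_
      push_cast
      gcongr
  calc (S.card : ℝ)
      = ∑ k ∈ Finset.Icc 1 ⌊x / D⌋₊, (Finset.card {n ∈ S | n / fibRank n = k} : ℝ) := by
        exact_mod_cast Finset.card_eq_sum_card_fiberwise hcofactor
    _ ≤ ⌊x / D⌋₊ * (x ^ s * ((2 / s) ^ Real.exp (1 / s) * (30 * x) ^ s)) := by
        simpa only [Nat.card_Icc, add_tsub_cancel_right, nsmul_eq_mul] using
          Finset.sum_le_card_nsmul _ _ _ hfiber
    _ ≤ _ := by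
        gcongr
        exact Nat.floor_le (by positivity)

theorem card_filter_fibRank_le_le {x η D B : ℝ} (hx : 0 ≤ x) (h0 : 0 < η) (h1 : η < 1)
    (hD : 1 ≤ D)
    (hB : ∀ d : ℕ, d ≠ 0 → (d : ℝ) ≤ D → eulerProd (Nat.fib d).primeFactors (1 - η) ≤ B) :
    (Finset.card {n ∈ selfFibFinset x | (fibRank n : ℝ) ≤ D} : ℝ) ≤
      x ^ (1 - η) * B * (D ^ η / η) := by
  set S : Finset ℕ := {n ∈ selfFibFinset x | (fibRank n : ℝ) ≤ D}
  have hS : ∀ n ∈ S, (n ≠ 0 ∧ fibRank n ∣ n ∧ (n : ℝ) ≤ x) ∧ fibRank n ≤ D := fun n hn ↦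
    (Finset.mem_filter.1 hn).imp_left mem_selfFibFinset.1
  have hrank : ∀ n ∈ S, fibRank n ∈ Finset.Icc 1 ⌊D⌋₊ := fun n hn ↦
    Finset.mem_Icc.2 ⟨(fibRank_spec (hS n hn).1.1).1, Nat.le_floor (hS n hn).2⟩
  have hB0 : 0 ≤ B := (eulerProd_nonneg (fun p ↦ Nat.prime_of_mem_primeFactors)
    (by linarith)).trans (hB 1 one_ne_zero (by simpa using hD))
  have hfiber : ∀ d ∈ Finset.Icc 1 ⌊D⌋₊, (Finset.card {n ∈ S | fibRank n = d} : ℝ) ≤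
      x ^ (1 - η) * B * (d : ℝ) ^ (η - 1) := fun d hd ↦ by
    obtain ⟨hd1, hdD⟩ := Finset.mem_Icc.1 hd
    have hd0 : d ≠ 0 := Nat.one_le_iff_ne_zero.1 hd1
    calc _ ≤ (x / d) ^ (1 - η) * eulerProd (Nat.fib d).primeFactors (1 - η) :=
          card_le_of_dvd_fib hd0 (by linarith) hx fun n hn ↦ by
            obtain ⟨hnS, rfl⟩ := Finset.mem_filter.1 hn
            exact ⟨(hS n hnS).1.2.1, dvd_fib_fibRank n, (hS n hnS).1.2.2⟩
      _ ≤ (x / d) ^ (1 - η) * B := by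
          gcongr
          exact hB d hd0 ((Nat.le_floor_iff' hd0).1 hdD)
      _ = x ^ (1 - η) * B * (d : ℝ) ^ (η - 1) := by
          rw [Real.div_rpow hx d.cast_nonneg, ← neg_sub 1 η, Real.rpow_neg d.cast_nonneg]
          ring
  calc (S.card : ℝ) = ∑ d ∈ Finset.Icc 1 ⌊D⌋₊, (Finset.card {n ∈ S | fibRank n = d} : ℝ) := by
        exact_mod_cast Finset.card_eq_sum_card_fiberwise hrank
    _ ≤ x ^ (1 - η) * B * ∑ d ∈ Finset.Icc 1 ⌊D⌋₊, (d : ℝ) ^ (η - 1) := by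
        rw [Finset.mul_sum]
        exact Finset.sum_le_sum hfiber
    _ ≤ x ^ (1 - η) * B * ((⌊D⌋₊ : ℝ) ^ η / η) := by
        gcongr
        exact sum_Icc_rpow_sub_one_le h0 h1.le _
    _ ≤ _ := by
        gcongr
        exact Nat.floor_le (by linarith)

theorem two_div_rpow_exp_inv_le {x s : ℝ} (hx : 1 < x) (hs : 0 < s)
    (hsx : 3 / s ≤ Real.log (Real.log x)) : (2 / s) ^ Real.exp (1 / s) ≤ x ^ s := by
  have hlogx : Real.exp (3 / s) ≤ Real.log x := (Real.le_log_iff_exp_le (Real.log_pos hx)).1 hsx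
  have hlog : Real.log (2 / s) ≤ s * Real.exp (2 / s) := calc
    Real.log (2 / s) ≤ 2 / s := Real.log_le_self (by positivity)
    _ = s * ((2 / s) ^ 2 / 2) := by field_simp
    _ ≤ s * Real.exp (2 / s) := by
      gcongr
      linarith [Real.quadratic_le_exp_of_nonneg (x := 2 / s) (by positivity),
        div_pos two_pos hs]
  rw [← Real.log_le_log_iff (by positivity) (by positivity), Real.log_rpow (by positivity),
    Real.log_rpow (by positivity)]
  calc Real.exp (1 / s) * Real.log (2 / s) ≤ Real.exp (1 / s) * (s * Real.exp (2 / s)) := by gcongr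
    _ = s * Real.exp (3 / s) := by
      rw [mul_left_comm, ← Real.exp_add]
      ring_nf
    _ ≤ s * Real.log x := by gcongr

theorem card_filter_rpow_lt_fibRank_le {x η s : ℝ} (hx : 30 ≤ x) (hη : 0 ≤ η) (hs0 : 0 < s)
    (hs1 : s ≤ 1) (hsx : 3 / s ≤ Real.log (Real.log x)) :
    (Finset.card {n ∈ selfFibFinset x | x ^ η < fibRank n} : ℝ) ≤ x ^ (1 - η + 4 * s) := by
  have hx0 : 0 < x := by linarith
  calc _ ≤ x / x ^ η * (x ^ s * ((2 / s) ^ Real.exp (1 / s) * (30 * x) ^ s)) :=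
        card_filter_lt_fibRank_le hx0.le (Real.one_le_rpow (by linarith) hη) hs0 hs1
    _ ≤ x / x ^ η * (x ^ s * (x ^ s * (x * x) ^ s)) := by
        gcongr
        exact two_div_rpow_exp_inv_le (by linarith) hs0 hsx
    _ = x ^ (1 - η + 4 * s) := by
        rw [Real.mul_rpow hx0.le hx0.le, Real.rpow_add hx0, Real.rpow_sub hx0, Real.rpow_one,
          show 4 * s = s + (s + (s + s)) by ring, Real.rpow_add hx0, Real.rpow_add hx0,
          Real.rpow_add hx0]

theorem card_filter_fibRank_le_rpow_le {x η s : ℝ} (hx : 1 ≤ x) (hlogx : Real.exp 1 ≤ Real.log x)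
    (h0 : 0 < η) (h1 : η ≤ 1 / 4)
    (hs : fibEulerBound η (Real.log x) + η ^ 2 * Real.log x + 1 / η ≤ s * Real.log x) :
    (Finset.card {n ∈ selfFibFinset x | (fibRank n : ℝ) ≤ x ^ η} : ℝ) ≤ x ^ (1 - η + s) := by
  have hx0 : 0 < x := one_pos.trans_le hx
  set E := fibEulerBound η (Real.log x)
  have hB : ∀ d : ℕ, d ≠ 0 → (d : ℝ) ≤ x ^ η →
      eulerProd (Nat.fib d).primeFactors (1 - η) ≤ Real.exp E := fun d hd hdx ↦ by
    refine eulerProd_primeFactors_fib_le h0 h1 hlogx hd (Real.log_le_log (by positivity) ?_)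
    exact hdx.trans (Real.rpow_le_self_of_one_le hx (by linarith))
  calc _ ≤ x ^ (1 - η) * Real.exp E * ((x ^ η) ^ η / η) :=
        card_filter_fibRank_le_le hx0.le h0 (by linarith) (Real.one_le_rpow hx h0.le) hB
    _ = x ^ (1 - η) * (Real.exp E * Real.exp (η ^ 2 * Real.log x) * (1 / η)) := by
        rw [← Real.rpow_mul hx0.le, ← sq, Real.rpow_def_of_pos hx0 (η ^ 2), mul_comm (Real.log x)]
        ring
    _ ≤ x ^ (1 - η) * (Real.exp E * Real.exp (η ^ 2 * Real.log x) * Real.exp (1 / η)) := by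
        gcongr
        linarith [Real.add_one_le_exp (1 / η)]
    _ = x ^ (1 - η) * Real.exp (E + η ^ 2 * Real.log x + 1 / η) := by
        rw [Real.exp_add, Real.exp_add]
    _ ≤ x ^ (1 - η) * Real.exp (s * Real.log x) := by gcongr
    _ = x ^ (1 - η + s) := by
        rw [Real.rpow_add hx0, Real.rpow_def_of_pos hx0 s, mul_comm s]

theorem selfFibCount_le_rpow {x η s : ℝ} (hx : 30 ≤ x) (h0 : 0 < η) (h1 : η ≤ 1 / 4)
    (hs0 : 0 < s) (hs1 : s ≤ 1) (hsx : 3 / s ≤ Real.log (Real.log x))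
    (hs : fibEulerBound η (Real.log x) + η ^ 2 * Real.log x + 1 / η ≤ s * Real.log x) :
    (selfFibCount x : ℝ) ≤ x ^ (1 - η + 5 * s) := by
  have hx0 : 0 < x := by linarith
  have htwo : 2 ≤ x ^ s := by
    have hlog : 3 ≤ s * Real.log x := calc
      3 ≤ s * Real.log (Real.log x) := (div_le_iff₀' hs0).1 hsx
      _ ≤ s * Real.log x := by
        have hlogx : 0 ≤ Real.log x := Real.log_nonneg (by linarith)
        exact mul_le_mul_of_nonneg_left (Real.log_le_self hlogx) hs0.le
    rw [Real.rpow_def_of_pos hx0, mul_comm]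
    linarith [Real.add_one_le_exp (s * Real.log x)]
  have hsplit : (selfFibCount x : ℝ) =
      (Finset.card {n ∈ selfFibFinset x | (fibRank n : ℝ) ≤ x ^ η} : ℝ) +
        (Finset.card {n ∈ selfFibFinset x | x ^ η < fibRank n} : ℝ) := by
    simp only [← not_le]
    rw [selfFibCount_eq_card, ← Nat.cast_add, Finset.card_filter_add_card_filter_not]
  have hlogx : Real.exp 1 ≤ Real.log x := by
    refine (Real.le_log_iff_exp_le (Real.log_pos (by linarith))).1 (le_trans ?_ hsx)
    rw [le_div_iff₀ hs0]
    linarith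
  have hsmall := card_filter_fibRank_le_rpow_le (by linarith) hlogx h0 h1 hs
  have hlarge := card_filter_rpow_lt_fibRank_le hx h0.le hs0 hs1 hsx
  calc (selfFibCount x : ℝ) ≤ x ^ (1 - η + 4 * s) + x ^ (1 - η + 4 * s) := by
        rw [hsplit]
        refine add_le_add (hsmall.trans ?_) hlarge
        gcongr
        · linarith
        · linarith
    _ = x ^ (1 - η + 4 * s) * 2 := (mul_two _).symm
    _ ≤ x ^ (1 - η + 4 * s) * x ^ s := by gcongr
    _ = x ^ (1 - η + 5 * s) := by
        rw [← Real.rpow_add hx0]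
        ring_nf

theorem eventually_rpow_mul_log_le {a : ℝ} (ha : a < 1) :
    ∀ᶠ u : ℝ in atTop, 4 * (u ^ a * (9 + 4 * Real.log u)) ≤ u / 2 := by
  have hb : 0 < 1 - a := sub_pos.2 ha
  have hlittleO : (fun u : ℝ ↦ 9 + 4 * Real.log u) =o[atTop] fun u ↦ u ^ (1 - a) :=
    (Asymptotics.isLittleO_const_left.2 <| .inr <| tendsto_norm_atTop_atTop.comp <|
      tendsto_rpow_atTop hb).add ((isLittleO_log_rpow_atTop hb).const_mul_left 4)
  filter_upwards [hlittleO.bound (show (0 : ℝ) < 1 / 8 by norm_num), eventually_gt_atTop 0]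
    with u hu hu0
  have hle : 9 + 4 * Real.log u ≤ 1 / 8 * u ^ (1 - a) :=
    (Real.le_norm_self _).trans (by rwa [Real.norm_of_nonneg (r := u ^ _) (by positivity)] at hu)
  calc 4 * (u ^ a * (9 + 4 * Real.log u)) ≤ 4 * (u ^ a * (1 / 8 * u ^ (1 - a))) := by gcongr
    _ = u ^ (a + (1 - a)) / 2 := by
      rw [Real.rpow_add hu0]
      ring
    _ = u / 2 := by rw [add_sub_cancel, Real.rpow_one]

theorem tendsto_log_div_self_atTop : Tendsto (fun u ↦ Real.log u / u) atTop (𝓝 0) :=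
  Real.isLittleO_log_id_atTop.tendsto_div_nhds_zero

theorem eventually_fibEulerBound_le {c : ℝ} (hc0 : 0 < c) (hc : c < 1 / 2) :
    ∀ᶠ u : ℝ in atTop, fibEulerBound (c * (Real.log u / u)) (Real.exp u) ≤
      36 / (c * (Real.log u / u)) * Real.exp (u / 2) := by
  filter_upwards [eventually_rpow_mul_log_le (show 2 * c < 1 by linarith), eventually_gt_atTop 1]
    with u hexponent hu
  have hlog : 0 < Real.log u := Real.log_pos hu
  have hpow : Real.exp u ^ (2 * (c * (Real.log u / u))) = u ^ (2 * c) := by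
    rw [← Real.exp_mul, Real.rpow_def_of_pos (by linarith)]
    field_simp
  rw [fibEulerBound, hpow, Real.log_exp]
  gcongr

theorem eventually_fibEulerBound_add_le {c δ : ℝ} (hc0 : 0 < c) (hc : c < 1 / 2) (hδ : 0 < δ) :
    ∀ᶠ u : ℝ in atTop,
      fibEulerBound (c * (Real.log u / u)) (Real.exp u) + (c * (Real.log u / u)) ^ 2 * Real.exp u +
        1 / (c * (Real.log u / u)) ≤ δ * (Real.log u / u) * Real.exp u := by
  have hsq : ∀ᶠ u : ℝ in atTop, u ^ 2 ≤ c * δ / 74 * Real.exp (u / 2) := by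
    filter_upwards [(isLittleO_pow_exp_pos_mul_atTop 2 one_half_pos).bound
      (show 0 < c * δ / 74 by positivity)] with u hu
    rwa [Real.norm_of_nonneg (sq_nonneg u), Real.norm_of_nonneg (Real.exp_pos _).le,
      one_div_mul_eq_div] at hu
  filter_upwards [hsq, eventually_fibEulerBound_le hc0 hc,
    tendsto_log_div_self_atTop.eventually_le_const (show 0 < δ / (2 * c ^ 2) by positivity),
    eventually_gt_atTop 0, Real.tendsto_log_atTop.eventually_ge_atTop 1]
    with u hsq hbound hr hu hlog
  set r := Real.log u / u with hr_def
  have hinv : 1 / u ≤ r := by rw [hr_def]; gcongr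
  have hr0 : 0 < r := (by positivity : 0 < 1 / u).trans_le hinv
  have hexp : Real.exp (u / 2) * Real.exp (u / 2) = Real.exp u := by
    rw [← Real.exp_add, add_halves]
  have hmain : 37 / (c * r) * Real.exp (u / 2) ≤ δ / 2 * r * Real.exp u := calc
    37 / (c * r) * Real.exp (u / 2) ≤ 37 / (c * (1 / u)) * Real.exp (u / 2) := by gcongr
    _ = 37 / (c * u) * u ^ 2 * Real.exp (u / 2) := by field_simp
    _ ≤ 37 / (c * u) * (c * δ / 74 * Real.exp (u / 2)) * Real.exp (u / 2) := by gcongr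
    _ = δ / 2 * (1 / u) * Real.exp u := by
      rw [← hexp]
      field_simp
      norm_num
    _ ≤ δ / 2 * r * Real.exp u := by gcongr
  have hsquare : (c * r) ^ 2 * Real.exp u ≤ δ / 2 * r * Real.exp u := by
    rw [le_div_iff₀ (by positivity)] at hr
    gcongr
    nlinarith
  have hone : 1 / (c * r) ≤ 1 / (c * r) * Real.exp (u / 2) :=
    le_mul_of_one_le_right (by positivity) (Real.one_le_exp (by positivity))
  calc _ ≤ 36 / (c * r) * Real.exp (u / 2) + δ / 2 * r * Real.exp u +
        1 / (c * r) * Real.exp (u / 2) := by gcongr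
    _ = 37 / (c * r) * Real.exp (u / 2) + δ / 2 * r * Real.exp u := by ring
    _ ≤ δ / 2 * r * Real.exp u + δ / 2 * r * Real.exp u := by gcongr
    _ = δ * r * Real.exp u := by ring

theorem eventually_selfFibCount_le_rpow {c : ℝ} (hc0 : 0 < c) (hc : c < 1 / 2) :
    ∀ᶠ x : ℝ in atTop, (selfFibCount x : ℝ) ≤
      x ^ (1 - c * (Real.log (Real.log (Real.log x)) / Real.log (Real.log x))) := by
  obtain ⟨b, hcb, hb⟩ := exists_between hc
  obtain ⟨δ, hδ, hδ_eq⟩ : ∃ δ, 0 < δ ∧ b - 5 * δ = c := ⟨(b - c) / 5, by linarith, by ring⟩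
  have hloglog : Tendsto (fun x : ℝ ↦ Real.log (Real.log x)) atTop atTop :=
    Real.tendsto_log_atTop.comp Real.tendsto_log_atTop
  have hratio := tendsto_log_div_self_atTop.comp hloglog
  filter_upwards [hloglog.eventually (eventually_fibEulerBound_add_le (hc0.trans hcb) hb hδ),
    hratio.eventually_le_const (show (0 : ℝ) < 1 / 2 by norm_num),
    hratio.eventually_le_const (show 0 < 1 / δ by positivity),
    hloglog.eventually_gt_atTop 0,
    (Real.tendsto_log_atTop.comp hloglog).eventually_ge_atTop (max 1 (3 / δ)),
    eventually_ge_atTop 30] with x hexponent hr hrδ hu hv hx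
  simp only [Function.comp_apply, max_le_iff] at hr hrδ hv
  rw [Real.exp_log (Real.log_pos (by linarith))] at hexponent
  set r := Real.log (Real.log (Real.log x)) / Real.log (Real.log x) with hr_def
  have hr0 : 0 < r := div_pos (by linarith) hu
  have hδr : 3 / (δ * r) ≤ Real.log (Real.log x) := by
    rw [hr_def, div_le_iff₀ (by positivity), mul_left_comm, mul_div_cancel₀ _ hu.ne',
      ← div_le_iff₀' hδ]
    exact hv.2
  have hle := selfFibCount_le_rpow hx (mul_pos (hc0.trans hcb) hr0) (by nlinarith)
    (mul_pos hδ hr0) ((le_div_iff₀' hδ).1 hrδ) hδr hexponent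
  rwa [show 1 - b * r + 5 * (δ * r) = 1 - (b - 5 * δ) * r by ring, hδ_eq] at hle

theorem log_selfFibCount_le_iff {x : ℝ} (hx : 1 ≤ x) (t : ℝ) :
    Real.log (selfFibCount x) ≤ Real.log x - t * (Real.log x *
        Real.log (Real.log (Real.log x)) / Real.log (Real.log x)) ↔
      (selfFibCount x : ℝ) ≤
        x ^ (1 - t * (Real.log (Real.log (Real.log x)) / Real.log (Real.log x))) := by
  rw [Real.le_rpow_iff_log_le (Nat.cast_pos.2 (one_le_selfFibCount hx)) (one_pos.trans_le hx)]
  ring_nf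

theorem exists_tendsto_zero_add_mul_le {α : Type*} {l : Filter α} {f g : α → ℝ} {a : ℝ}
    (hg : ∀ᶠ x in l, 0 < g x) (h : ∀ᶠ c in 𝓝[<] a, ∀ᶠ x in l, c * g x ≤ f x) :
    ∃ ε : α → ℝ, Tendsto ε l (𝓝 0) ∧ ∀ᶠ x in l, (a + ε x) * g x ≤ f x := by
  refine ⟨fun x ↦ min 0 (f x / g x - a), ?_, ?_⟩
  · rw [tendsto_order]
    refine ⟨fun b hb ↦ ?_, fun b hb ↦ .of_forall fun x ↦ (min_le_left _ _).trans_lt hb⟩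
    obtain ⟨c, hc, hbc⟩ := (h.and (Ioo_mem_nhdsLT (show a + b < a by linarith))).exists
    filter_upwards [hg, hc] with x hx hfx
    rw [← le_div_iff₀ hx] at hfx
    exact lt_min hb (by linarith [hbc.1])
  · filter_upwards [hg] with x hx
    rw [← le_div_iff₀ hx]
    linarith [min_le_right 0 (f x / g x - a)]

theorem theorem1 :
    ∃ ε : ℝ → ℝ, Tendsto ε atTop (𝓝 0) ∧
      ∀ᶠ x : ℝ in atTop,
        Real.log (selfFibCount x : ℝ) ≤
            Real.log x - (1 / 2 + ε x) *
              (Real.log x * Real.log (Real.log (Real.log x)) / Real.log (Real.log x)) ∧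
        (selfFibCount x : ℝ) ≤
            x ^ (1 - (1 / 2 + ε x) *
              (Real.log (Real.log (Real.log x)) / Real.log (Real.log x))) := by
  have hloglog : Tendsto (fun x : ℝ ↦ Real.log (Real.log x)) atTop atTop :=
    Real.tendsto_log_atTop.comp Real.tendsto_log_atTop
  have hscale : ∀ᶠ x in atTop, 0 < Real.log x * Real.log (Real.log (Real.log x)) /
      Real.log (Real.log x) := by
    filter_upwards [Real.tendsto_log_atTop.eventually_gt_atTop 0, hloglog.eventually_gt_atTop 0,
      (Real.tendsto_log_atTop.comp hloglog).eventually_gt_atTop 0] with x hlog hloglog hlogloglog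
    exact div_pos (mul_pos hlog hlogloglog) hloglog
  obtain ⟨ε, hε, hle⟩ := exists_tendsto_zero_add_mul_le (a := 1 / 2) hscale
    (f := fun x ↦ Real.log x - Real.log (selfFibCount x)) <| by
      filter_upwards [Ioo_mem_nhdsLT one_half_pos] with c hc
      filter_upwards [eventually_selfFibCount_le_rpow hc.1 hc.2, eventually_ge_atTop 1] with x hA hx
      exact le_sub_comm.1 ((log_selfFibCount_le_iff hx c).2 hA)
  refine ⟨ε, hε, ?_⟩
  filter_upwards [hle, eventually_ge_atTop 1] with x hle hx
  have hlog := le_sub_comm.1 hle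
  exact ⟨hlog, (log_selfFibCount_le_iff hx _).1 hlog⟩
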